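/- Theorem. Let $\mathcal{C}$ be a regular category: a category with finite limits in which every morphism factors as a regular epimorphism followed by a monomorphism and regular epimorphisms are stable under pullback. Let $\mathrm{Rel}(\mathcal{C})$ be the monoidal dagger category whose objects are those of $\mathcal{C}$, whose morphisms $A \to B$ are the subobjects $R \rightarrowtail A \times B$, in which the composite of $R \rightarrowtail A \times B$ and $S \rightarrowtail B \times D$ is the regular image of $R \times_B S \to A \times D$, the identity on $A$ is the diagonal, the tensor product is the product of $\mathcal{C}$ (with unit $I = 1$), and the dagger is the opposite relation. A special dagger Frobenius structure on $A$ in $\mathrm{Rel}(\mathcal{C})$ is a monoid $\mu : A \otimes A \to A$, $\eta : I \to A$ such that, with $\delta = \mu^\dagger$ and $\varepsilon = \eta^\dagger$, $(A, \delta, \varepsilon)$ is a comonoid, $(\mu \otimes \mathrm{id}_A)\circ(\mathrm{id}_A \otimes \delta) = (\mathrm{id}_A \otimes \mu)\circ(\delta \otimes \mathrm{id}_A)$, and $\mu \circ \delta = \mathrm{id}_A$. An internal groupoid in $\mathcal{C}$ with object of morphisms $A$ consists of an object $A_0$ and morphisms $s, t : A \to A_0$ (source and target), $u : A_0 \to A$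 (identities), $m : A \times_{A_0} A \to A$ (composition, where $A \times_{A_0} A$ is the pullback of $s$ and $t$) and $i : A \to A$ (inverses), satisfying the usual groupoid equations. For every object $A$ of $\mathcal{C}$ there is a bijection between - internal groupoids in $\mathcal{C}$ with object of morphisms $A$, where two of them are identified if there is an isomorphism of internal groupoids between them that is the identity on $A$ (so that $A_0$ matters only up to isomorphism), and - special dagger Frobenius structures on $A$ in $\mathrm{Rel}(\mathcal{C})$. It sends the class of a groupoid $(A_0, A, s, t, u, m, i)$ to the structure whose multiplication $\mu$ is the relation $A \times A \leftarrowtail A \times_{A_0} A \xrightarrow{\,m\,} A$, that is, the subobject of $(A \times A) \times A$ represented by $A \times_{A_0} A \to (A \times A) \times A$, $(a,b) \mapsto ((a,b), m(a,b))$, and whose unit $\eta : I \to A$ is the subobject $u : A_0 \rightarrowtail A$ of $1 \times A \cong A$. -/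

import Mathlib

open CategoryTheory Limits MonoidalCategory CartesianMonoidalCategory

universe v u

/-! ## Relations in a regular category -/

namespace RegRel

theorem isRegularEpi_comp {C : Type u} [Category.{v} C] [Regular C] {X Y Z : C} (p : X ⟶ Y) (q : Y ⟶ Z) [IsRegularEpi p] [IsRegularEpi q] :
    IsRegularEpi (p ≫ q) := by
  have : StrongEpi (p ≫ q) := strongEpi_comp p q
  infer_instance

section

variable {C : Type u} [Category.{v} C] [CartesianMonoidalCategory C]

instance mono_graph {A B : C} (f : A ⟶ B) : Mono (lift (𝟙 A) f) :=
  ⟨fun g h e => by simpa using congrArg (fun k => k ≫ fst A B) e⟩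

/-- The graph of a morphism `f : A ⟶ B`, the relation represented by `(𝟙, f) : A ⟶ A × B`. -/
noncomputable def graph {A B : C} (f : A ⟶ B) : Subobject (A ⊗ B) :=
  Subobject.mk (lift (𝟙 A) f)

/-- `Mem R a b`: the generalised elements `a` of `A` and `b` of `B` are related by `R`. -/
def Mem {T A B : C} (R : Subobject (A ⊗ B)) (a : T ⟶ A) (b : T ⟶ B) : Prop :=
  R.Factors (lift a b)

theorem mem_precomp {T T' A B : C} {R : Subobject (A ⊗ B)} {a : T ⟶ A} {b : T ⟶ B}
    (h : Mem R a b) (p : T' ⟶ T) : Mem R (p ≫ a) (p ≫ b) := by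
  have := Subobject.factors_of_factors_right (P := R) p h
  rwa [comp_lift] at this

theorem mem_arrow {A B : C} (R : Subobject (A ⊗ B)) :
    Mem R (R.arrow ≫ fst A B) (R.arrow ≫ snd A B) := by
  unfold Mem
  rw [lift_comp_fst_snd]
  exact (Subobject.factors_iff _ _).2 ⟨𝟙 _, by simp⟩

theorem mem_iff {T A B : C} (R : Subobject (A ⊗ B)) (a : T ⟶ A) (b : T ⟶ B) :
    Mem R a b ↔ ∃ k : T ⟶ (R : C), k ≫ R.arrow ≫ fst A B = a ∧ k ≫ R.arrow ≫ snd A B = b := by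
  constructor
  · intro h
    have h' : R.Factors (lift a b) := h
    refine ⟨R.factorThru _ h', ?_, ?_⟩
    · rw [← Category.assoc, Subobject.factorThru_arrow, lift_fst]
    · rw [← Category.assoc, Subobject.factorThru_arrow, lift_snd]
  · rintro ⟨k, rfl, rfl⟩
    exact mem_precomp (mem_arrow R) k

theorem mem_mk {T X A B : C} (r : X ⟶ A ⊗ B) [Mono r] (a : T ⟶ A) (b : T ⟶ B) :
    Mem (Subobject.mk r) a b ↔ ∃ k : T ⟶ X, k ≫ r ≫ fst A B = a ∧ k ≫ r ≫ snd A B = b := by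
  unfold Mem
  rw [Subobject.mk_factors_iff]
  constructor
  · intro ⟨(k : T ⟶ X), (hk : k ≫ r = lift a b)⟩
    exact ⟨k, by rw [← Category.assoc, hk, lift_fst], by rw [← Category.assoc, hk, lift_snd]⟩
  · rintro ⟨k, rfl, rfl⟩
    exact ⟨k, by change k ≫ r = _; ext <;> simp⟩

theorem le_of_mem {A B : C} {R S : Subobject (A ⊗ B)}
    (h : ∀ (T : C) (a : T ⟶ A) (b : T ⟶ B), Mem R a b → Mem S a b) : R ≤ S := by
  have := h _ _ _ (mem_arrow R)
  unfold Mem at this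
  rw [lift_comp_fst_snd] at this
  exact Subobject.le_of_comm (S.factorThru _ this) (by simp)

theorem ext_mem {A B : C} {R S : Subobject (A ⊗ B)}
    (h : ∀ (T : C) (a : T ⟶ A) (b : T ⟶ B), Mem R a b ↔ Mem S a b) : R = S :=
  le_antisymm (le_of_mem fun T a b => (h T a b).1) (le_of_mem fun T a b => (h T a b).2)

theorem mem_graph {T A B : C} (f : A ⟶ B) (a : T ⟶ A) (b : T ⟶ B) :
    Mem (graph f) a b ↔ a ≫ f = b := by
  unfold graph
  rw [mem_mk]
  constructor
  · rintro ⟨k, rfl, rfl⟩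
    simp
  · rintro rfl
    exact ⟨a, by simp, by simp⟩

/-- Membership may be tested on a regular epimorphic cover. -/
theorem mem_of_cover {T T' A B : C} {R : Subobject (A ⊗ B)} {a : T ⟶ A} {b : T ⟶ B}
    (p : T' ⟶ T) [IsRegularEpi p] (h : Mem R (p ≫ a) (p ≫ b)) : Mem R a b := by
  unfold Mem at h
  rw [← comp_lift] at h
  have sq : CommSq (R.factorThru _ h) p R.arrow (lift a b) := ⟨by simp⟩
  have : sq.HasLift := inferInstance
  exact (Subobject.factors_iff _ _).2 ⟨sq.lift, sq.fac_right⟩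

variable [Regular C]

/-- The composite of `R ↣ A × B` and `S ↣ B × D`: the image of the canonical morphism
`R ×_B S ⟶ A × D`. -/
noncomputable def comp {A B D : C} (R : Subobject (A ⊗ B)) (S : Subobject (B ⊗ D)) :
    Subobject (A ⊗ D) :=
  imageSubobject
    (lift (pullback.fst (R.arrow ≫ snd A B) (S.arrow ≫ fst B D) ≫ R.arrow ≫ fst A B)
      (pullback.snd (R.arrow ≫ snd A B) (S.arrow ≫ fst B D) ≫ S.arrow ≫ snd B D))

/-- The opposite relation: `{(b, a) | R(a, b)}`. -/
noncomputable def conv {A B : C} (R : Subobject (A ⊗ B)) : Subobject (B ⊗ A) :=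
  (Subobject.pullback (lift (snd B A) (fst B A))).obj R

/-- The product of relations: `{((a, a'), (b, b')) | R(a, b) ∧ S(a', b')}`. -/
noncomputable def prod {A B A' B' : C} (R : Subobject (A ⊗ B)) (S : Subobject (A' ⊗ B')) :
    Subobject ((A ⊗ A') ⊗ (B ⊗ B')) :=
  (Subobject.pullback (fst A A' ⊗ₘ fst B B')).obj R ⊓
    (Subobject.pullback (snd A A' ⊗ₘ snd B B')).obj S

theorem mem_conv {T A B : C} (R : Subobject (A ⊗ B)) (b : T ⟶ B) (a : T ⟶ A) :
    Mem (conv R) b a ↔ Mem R a b := by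
  unfold Mem conv
  rw [pullback_factors_iff, comp_lift, lift_fst, lift_snd]

theorem mem_prod {T A B A' B' : C} (R : Subobject (A ⊗ B)) (S : Subobject (A' ⊗ B'))
    (x : T ⟶ A ⊗ A') (y : T ⟶ B ⊗ B') :
    Mem (prod R S) x y ↔
      Mem R (x ≫ fst A A') (y ≫ fst B B') ∧ Mem S (x ≫ snd A A') (y ≫ snd B B') := by
  unfold Mem prod
  rw [Subobject.inf_factors, pullback_factors_iff, pullback_factors_iff,
    lift_map, lift_map]

theorem mem_comp {T A B D : C} (R : Subobject (A ⊗ B)) (S : Subobject (B ⊗ D))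
    (a : T ⟶ A) (d : T ⟶ D) :
    Mem (comp R S) a d ↔ ∃ (T' : C) (p : T' ⟶ T) (_ : IsRegularEpi p) (b : T' ⟶ B),
      Mem R (p ≫ a) b ∧ Mem S b (p ≫ d) := by
  set r := R.arrow ≫ snd A B with hr
  set s := S.arrow ≫ fst B D with hs
  set f := lift (pullback.fst r s ≫ R.arrow ≫ fst A B) (pullback.snd r s ≫ S.arrow ≫ snd B D)
    with hf
  have hcomp : comp R S = imageSubobject f := rfl
  rw [hcomp]
  constructor
  · intro h
    have : StrongEpi (factorThruImageSubobject f) := by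
      unfold factorThruImageSubobject
      exact strongEpi_comp _ _
    obtain ⟨k, h1, h2⟩ := (mem_iff _ _ _).1 h
    have w := pullback.condition (f := k) (g := factorThruImageSubobject f)
    have e1 : pullback.fst k (factorThruImageSubobject f) ≫ k ≫ (imageSubobject f).arrow =
        pullback.snd k (factorThruImageSubobject f) ≫ f := by
      rw [← Category.assoc, w, Category.assoc, imageSubobject_arrow_comp]
    refine ⟨pullback k (factorThruImageSubobject f), pullback.fst _ _, inferInstance,
      pullback.snd k (factorThruImageSubobject f) ≫ pullback.fst r s ≫ r, ?_, ?_⟩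
    · rw [mem_iff]
      refine ⟨pullback.snd k (factorThruImageSubobject f) ≫ pullback.fst r s, ?_, by simp [hr]⟩
      rw [← h1]
      have := congrArg (fun z => z ≫ fst A D) e1
      simpa [hf] using this.symm
    · rw [mem_iff]
      refine ⟨pullback.snd k (factorThruImageSubobject f) ≫ pullback.snd r s, ?_, ?_⟩
      · rw [pullback.condition (f := r) (g := s)]
        simp [hs]
      · rw [← h2]
        have := congrArg (fun z => z ≫ snd A D) e1
        simpa [hf] using this.symm
  · rintro ⟨T', p, hp, b, hR, hS⟩
    obtain ⟨k, k1, k2⟩ := (mem_iff _ _ _).1 hR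
    obtain ⟨l, l1, l2⟩ := (mem_iff _ _ _).1 hS
    refine mem_of_cover p ?_
    rw [mem_iff]
    refine ⟨pullback.lift k l (by rw [hr, hs, k2, l1]) ≫ factorThruImageSubobject f, ?_, ?_⟩
    · rw [Category.assoc, ← Category.assoc (factorThruImageSubobject f), imageSubobject_arrow_comp,
        hf, lift_fst, pullback.lift_fst_assoc, k1]
    · rw [Category.assoc, ← Category.assoc (factorThruImageSubobject f), imageSubobject_arrow_comp,
        hf, lift_snd, pullback.lift_snd_assoc, l2]

theorem mem_graph_comp {T A B D : C} (f : A ⟶ B) (S : Subobject (B ⊗ D))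
    (a : T ⟶ A) (d : T ⟶ D) : Mem (comp (graph f) S) a d ↔ Mem S (a ≫ f) d := by
  rw [mem_comp]
  constructor
  · rintro ⟨T', p, hp, b, h, h'⟩
    rw [mem_graph] at h
    subst h
    rw [Category.assoc] at h'
    exact mem_of_cover p h'
  · intro h
    exact ⟨T, 𝟙 T, inferInstance, a ≫ f, by simp [mem_graph], by simpa using h⟩

theorem mem_comp_graph {T A B D : C} (R : Subobject (A ⊗ B)) (e : B ≅ D)
    (a : T ⟶ A) (d : T ⟶ D) : Mem (comp R (graph e.hom)) a d ↔ Mem R a (d ≫ e.inv) := by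
  rw [mem_comp]
  constructor
  · rintro ⟨T', p, hp, b, h, h'⟩
    rw [mem_graph, ← Iso.eq_comp_inv, Category.assoc] at h'
    subst h'
    exact mem_of_cover p h
  · intro h
    exact ⟨T, 𝟙 T, inferInstance, d ≫ e.inv, by simpa using h, by simp [mem_graph]⟩

theorem id_comp {A B : C} (R : Subobject (A ⊗ B)) : comp (graph (𝟙 A)) R = R :=
  ext_mem fun T a b => by rw [mem_graph_comp, Category.comp_id]

theorem comp_id {A B : C} (R : Subobject (A ⊗ B)) : comp R (graph (𝟙 B)) = R :=
  ext_mem fun T a b => by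
    rw [← Iso.refl_hom, mem_comp_graph, Iso.refl_inv, Category.comp_id]

theorem comp_assoc {A B D E : C} (R : Subobject (A ⊗ B)) (S : Subobject (B ⊗ D))
    (Q : Subobject (D ⊗ E)) : comp (comp R S) Q = comp R (comp S Q) := by
  refine ext_mem fun T a e => ?_
  constructor
  · intro h
    obtain ⟨T₁, p, hp, d, h1, h2⟩ := (mem_comp _ _ _ _).1 h
    obtain ⟨T₂, q, hq, b, h3, h4⟩ := (mem_comp _ _ _ _).1 h1
    have := isRegularEpi_comp q p
    refine (mem_comp _ _ _ _).2 ⟨T₂, q ≫ p, this, b, by simpa using h3, ?_⟩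
    refine (mem_comp _ _ _ _).2 ⟨T₂, 𝟙 _, inferInstance, q ≫ d, by simpa using h4, ?_⟩
    simpa using mem_precomp h2 q
  · intro h
    obtain ⟨T₁, p, hp, b, h1, h2⟩ := (mem_comp _ _ _ _).1 h
    obtain ⟨T₂, q, hq, d, h3, h4⟩ := (mem_comp _ _ _ _).1 h2
    have := isRegularEpi_comp q p
    refine (mem_comp _ _ _ _).2 ⟨T₂, q ≫ p, this, d, ?_, by simpa using h4⟩
    refine (mem_comp _ _ _ _).2 ⟨T₂, 𝟙 _, inferInstance, q ≫ b, ?_, by simpa using h3⟩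
    simpa using mem_precomp h1 q

theorem graph_comp {A B D : C} (f : A ⟶ B) (g : B ⟶ D) :
    comp (graph f) (graph g) = graph (f ≫ g) :=
  ext_mem fun T a b => by rw [mem_graph_comp, mem_graph, mem_graph, Category.assoc]

theorem prod_graph {A B A' B' : C} (f : A ⟶ B) (g : A' ⟶ B') :
    prod (graph f) (graph g) = graph (f ⊗ₘ g) :=
  ext_mem fun T a b => by
    rw [mem_prod, mem_graph, mem_graph, mem_graph]
    constructor
    · rintro ⟨h1, h2⟩
      ext <;> simp_all
    · rintro rfl
      simp

theorem prod_comp {A B D A' B' D' : C} (R : Subobject (A ⊗ B)) (R' : Subobject (A' ⊗ B'))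
    (S : Subobject (B ⊗ D)) (S' : Subobject (B' ⊗ D')) :
    comp (prod R R') (prod S S') = prod (comp R S) (comp R' S') := by
  refine ext_mem fun T a d => ?_
  rw [mem_comp, mem_prod, mem_comp, mem_comp]
  constructor
  · rintro ⟨T', p, hp, b, h, h'⟩
    rw [mem_prod] at h h'
    simp only [Category.assoc] at h h'
    exact ⟨⟨T', p, hp, _, h.1, h'.1⟩, ⟨T', p, hp, _, h.2, h'.2⟩⟩
  · rintro ⟨⟨T₁, p, hp, b, h1, h2⟩, ⟨T₂, q, hq, b', h3, h4⟩⟩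
    have hc := pullback.condition (f := p) (g := q)
    refine ⟨pullback p q, pullback.fst p q ≫ p, isRegularEpi_comp _ _,
      lift (pullback.fst p q ≫ b) (pullback.snd p q ≫ b'), ?_, ?_⟩
    · rw [mem_prod]
      refine ⟨by simpa using mem_precomp h1 (pullback.fst p q), ?_⟩
      rw [hc]
      simpa using mem_precomp h3 (pullback.snd p q)
    · rw [mem_prod]
      refine ⟨by simpa using mem_precomp h2 (pullback.fst p q), ?_⟩
      rw [hc]
      simpa using mem_precomp h4 (pullback.snd p q)

theorem conv_graph_iso {A B : C} (e : A ≅ B) : conv (graph e.hom) = graph e.inv :=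
  ext_mem fun T b a => by
    rw [mem_conv, mem_graph, mem_graph, ← Iso.eq_comp_inv, eq_comm]

theorem conv_conv {A B : C} (R : Subobject (A ⊗ B)) : conv (conv R) = R :=
  ext_mem fun T a b => by rw [mem_conv, mem_conv]

theorem conv_comp {A B D : C} (R : Subobject (A ⊗ B)) (S : Subobject (B ⊗ D)) :
    conv (comp R S) = comp (conv S) (conv R) := by
  refine ext_mem fun T d a => ?_
  simp only [mem_conv, mem_comp]
  exact ⟨fun ⟨T', p, hp, b, h, h'⟩ => ⟨T', p, hp, b, h', h⟩,
    fun ⟨T', p, hp, b, h, h'⟩ => ⟨T', p, hp, b, h', h⟩⟩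

theorem conv_prod {A B A' B' : C} (R : Subobject (A ⊗ B)) (S : Subobject (A' ⊗ B')) :
    conv (prod R S) = prod (conv R) (conv S) :=
  ext_mem fun T b a => by simp only [mem_conv, mem_prod]

end

end RegRel

/-! ## Monoidal dagger categories and Frobenius structures -/

/-- A monoidal dagger category. -/
class MonoidalDaggerCategory (D : Type u) [Category.{v} D] [MonoidalCategory D] where
  dag {X Y : D} : (X ⟶ Y) → (Y ⟶ X)
  dag_id (X : D) : dag (𝟙 X) = 𝟙 X
  dag_comp {X Y Z : D} (f : X ⟶ Y) (g : Y ⟶ Z) : dag (f ≫ g) = dag g ≫ dag f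
  dag_dag {X Y : D} (f : X ⟶ Y) : dag (dag f) = f
  dag_tensor {X Y X' Y' : D} (f : X ⟶ Y) (g : X' ⟶ Y') : dag (f ⊗ₘ g) = dag f ⊗ₘ dag g
  dag_associator (X Y Z : D) : dag (α_ X Y Z).hom = (α_ X Y Z).inv
  dag_leftUnitor (X : D) : dag (λ_ X).hom = (λ_ X).inv
  dag_rightUnitor (X : D) : dag (ρ_ X).hom = (ρ_ X).inv

/-- A Frobenius structure on the object `A` of a monoidal category: a monoid and a comonoid
structure on `A` that satisfy the Frobenius law. -/
structure FrobeniusStructure {D : Type u} [Category.{v} D] [MonoidalCategory D] (A : D)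
    extends MonObj A, ComonObj A where
  frobenius : A ◁ comul ≫ (α_ A A A).inv ≫ mul ▷ A = comul ▷ A ≫ (α_ A A A).hom ≫ A ◁ mul

/-- A special dagger Frobenius structure on the object `A` of a monoidal dagger category. -/
structure SpecialDaggerFrobeniusStructure {D : Type u} [Category.{v} D] [MonoidalCategory D]
    [MonoidalDaggerCategory D] (A : D) extends FrobeniusStructure A where
  special : comul ≫ mul = 𝟙 A
  comul_eq : comul = MonoidalDaggerCategory.dag mul
  counit_eq : counit = MonoidalDaggerCategory.dag one

/-! ## The monoidal dagger category of relations -/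

/-- The type of objects of `Rel(C)`, a copy of the type of objects of `C`. -/
structure RelCategory (C : Type u) where
  base : C

namespace RelCategory

section

variable {C : Type u} [Category.{v} C] [CartesianMonoidalCategory C] [Regular C]

/-- Morphisms from `A` to `B` in `Rel(C)` are subobjects of `A × B`. -/
noncomputable instance : Category.{max u v} (RelCategory C) where
  Hom A B := Subobject (A.base ⊗ B.base)
  id A := RegRel.graph (𝟙 A.base)
  comp R S := RegRel.comp R S
  id_comp R := RegRel.id_comp R
  comp_id R := RegRel.comp_id R
  assoc R S Q := RegRel.comp_assoc R S Q

/-- An isomorphism of `C` gives an isomorphism of `Rel(C)`. -/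
noncomputable def graphIso {A B : C} (e : A ≅ B) : (⟨A⟩ : RelCategory C) ≅ ⟨B⟩ where
  hom := RegRel.graph e.hom
  inv := RegRel.graph e.inv
  hom_inv_id := (RegRel.graph_comp e.hom e.inv).trans (by rw [e.hom_inv_id]; rfl)
  inv_hom_id := (RegRel.graph_comp e.inv e.hom).trans (by rw [e.inv_hom_id]; rfl)

noncomputable instance : MonoidalCategoryStruct (RelCategory C) where
  tensorObj A B := ⟨A.base ⊗ B.base⟩
  tensorHom R S := RegRel.prod R S
  whiskerLeft A _ _ R := RegRel.prod (RegRel.graph (𝟙 A.base)) R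
  whiskerRight R B := RegRel.prod R (RegRel.graph (𝟙 B.base))
  tensorUnit := ⟨𝟙_ C⟩
  associator A B D := graphIso (α_ A.base B.base D.base)
  leftUnitor A := graphIso (λ_ A.base)
  rightUnitor A := graphIso (ρ_ A.base)

noncomputable instance : MonoidalCategory (RelCategory C) :=
  MonoidalCategory.ofTensorHom
    (id_tensorHom_id := fun A B => (RegRel.prod_graph (𝟙 A.base) (𝟙 B.base)).trans
      (congrArg RegRel.graph (MonoidalCategory.id_tensorHom_id A.base B.base)))
    (id_tensorHom := fun _ _ _ _ => rfl)
    (tensorHom_id := fun _ _ => rfl)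
    (tensorHom_comp_tensorHom := fun R R' S S' => RegRel.prod_comp R R' S S')
    (associator_naturality := fun {A₁ A₂ A₃ B₁ B₂ B₃} R₁ R₂ R₃ => by
      change RegRel.comp (RegRel.prod (RegRel.prod R₁ R₂) R₃)
          (RegRel.graph (α_ B₁.base B₂.base B₃.base).hom) =
        RegRel.comp (RegRel.graph (α_ A₁.base A₂.base A₃.base).hom)
          (RegRel.prod R₁ (RegRel.prod R₂ R₃))
      refine RegRel.ext_mem fun T a b => ?_
      rw [RegRel.mem_comp_graph, RegRel.mem_graph_comp]
      simp [RegRel.mem_prod, and_assoc])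
    (leftUnitor_naturality := fun {A B} R => by
      change RegRel.comp (RegRel.prod (RegRel.graph (𝟙 (𝟙_ C))) R)
          (RegRel.graph (λ_ B.base).hom) =
        RegRel.comp (RegRel.graph (λ_ A.base).hom) R
      refine RegRel.ext_mem fun T a b => ?_
      rw [RegRel.mem_comp_graph, RegRel.mem_graph_comp]
      simp [RegRel.mem_prod, RegRel.mem_graph, leftUnitor_hom, eq_iff_true_of_subsingleton])
    (rightUnitor_naturality := fun {A B} R => by
      change RegRel.comp (RegRel.prod R (RegRel.graph (𝟙 (𝟙_ C))))
          (RegRel.graph (ρ_ B.base).hom) =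
        RegRel.comp (RegRel.graph (ρ_ A.base).hom) R
      refine RegRel.ext_mem fun T a b => ?_
      rw [RegRel.mem_comp_graph, RegRel.mem_graph_comp]
      simp [RegRel.mem_prod, RegRel.mem_graph, rightUnitor_hom, eq_iff_true_of_subsingleton])
    (pentagon := fun W X Y Z => by
      change RegRel.comp (RegRel.prod (RegRel.graph (α_ W.base X.base Y.base).hom)
          (RegRel.graph (𝟙 Z.base))) (RegRel.comp
            (RegRel.graph (α_ W.base (X.base ⊗ Y.base) Z.base).hom)
            (RegRel.prod (RegRel.graph (𝟙 W.base))
              (RegRel.graph (α_ X.base Y.base Z.base).hom))) =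
        RegRel.comp (RegRel.graph (α_ (W.base ⊗ X.base) Y.base Z.base).hom)
          (RegRel.graph (α_ W.base X.base (Y.base ⊗ Z.base)).hom)
      rw [RegRel.prod_graph, RegRel.prod_graph, RegRel.graph_comp, RegRel.graph_comp,
        RegRel.graph_comp]
      simp)
    (triangle := fun X Y => by
      change RegRel.comp (RegRel.graph (α_ X.base (𝟙_ C) Y.base).hom)
          (RegRel.prod (RegRel.graph (𝟙 X.base)) (RegRel.graph (λ_ Y.base).hom)) =
        RegRel.prod (RegRel.graph (ρ_ X.base).hom) (RegRel.graph (𝟙 Y.base))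
      rw [RegRel.prod_graph, RegRel.prod_graph, RegRel.graph_comp]
      simp)

noncomputable instance : MonoidalDaggerCategory (RelCategory C) where
  dag R := RegRel.conv R
  dag_id A := RegRel.conv_graph_iso (Iso.refl A.base)
  dag_comp R S := RegRel.conv_comp R S
  dag_dag R := RegRel.conv_conv R
  dag_tensor R S := RegRel.conv_prod R S
  dag_associator A B D := RegRel.conv_graph_iso (α_ A.base B.base D.base)
  dag_leftUnitor A := RegRel.conv_graph_iso (λ_ A.base)
  dag_rightUnitor A := RegRel.conv_graph_iso (ρ_ A.base)

end

end RelCategory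

/-! ## Internal groupoids -/

/-- An internal category with object of objects `A₀` and object of morphisms `A₁`. The composite
of a composable pair `(a, b)` of generalised elements of `A₁`, meaning `s a = t b`, is
`pullback.lift a b _ ≫ m` (first `b`, then `a`). -/
structure InternalCategory {C : Type u} [Category.{v} C] [HasPullbacks C] (A₀ A₁ : C) where
  s : A₁ ⟶ A₀
  t : A₁ ⟶ A₀
  u : A₀ ⟶ A₁
  m : pullback s t ⟶ A₁
  u_s : u ≫ s = 𝟙 A₀
  u_t : u ≫ t = 𝟙 A₀
  m_s : m ≫ s = pullback.snd s t ≫ s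
  m_t : m ≫ t = pullback.fst s t ≫ t
  id_left : pullback.lift (t ≫ u) (𝟙 A₁) (by simp [u_s]) ≫ m = 𝟙 A₁
  id_right : pullback.lift (𝟙 A₁) (s ≫ u) (by simp [u_t]) ≫ m = 𝟙 A₁
  assoc {T : C} (a b c : T ⟶ A₁) (hab : a ≫ s = b ≫ t) (hbc : b ≫ s = c ≫ t) :
    pullback.lift (pullback.lift a b hab ≫ m) c
      (by rw [Category.assoc, m_s, pullback.lift_snd_assoc, hbc]) ≫ m =
      pullback.lift a (pullback.lift b c hbc ≫ m)
        (by rw [Category.assoc, m_t, pullback.lift_fst_assoc, hab]) ≫ m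

/-- An internal groupoid with object of objects `A₀` and object of morphisms `A₁`. -/
structure InternalGroupoid {C : Type u} [Category.{v} C] [HasPullbacks C] (A₀ A₁ : C)
    extends InternalCategory A₀ A₁ where
  i : A₁ ⟶ A₁
  i_s : i ≫ s = t
  i_t : i ≫ t = s
  inv_left : pullback.lift i (𝟙 A₁) (by simp [i_s]) ≫ m = s ≫ u
  inv_right : pullback.lift (𝟙 A₁) i (by simp [i_t]) ≫ m = t ≫ u

/-- The morphisms `f₀`, `f₁` form an internal functor from `G` to `H`. -/
structure InternalCategory.IsFunctor {C : Type u} [Category.{v} C] [HasPullbacks C]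
    {A₀ A₁ B₀ B₁ : C} (G : InternalCategory A₀ A₁) (H : InternalCategory B₀ B₁)
    (f₀ : A₀ ⟶ B₀) (f₁ : A₁ ⟶ B₁) : Prop where
  s : f₁ ≫ H.s = G.s ≫ f₀
  t : f₁ ≫ H.t = G.t ≫ f₀
  u : f₀ ≫ H.u = G.u ≫ f₁
  m : G.m ≫ f₁ =
    pullback.lift (pullback.fst G.s G.t ≫ f₁) (pullback.snd G.s G.t ≫ f₁)
      (by rw [Category.assoc, Category.assoc, s, t, pullback.condition_assoc]) ≫ H.m

/-- An internal groupoid in `C` whose object of morphisms is `A`. -/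
structure GroupoidOn {C : Type u} [Category.{v} C] [HasPullbacks C] (A : C) where
  obj : C
  str : InternalGroupoid obj A

namespace GroupoidOn

section

variable {C : Type u} [Category.{v} C] [HasPullbacks C] {A : C}

theorem lift_fst_snd_eq {X Y Z : C} (f : X ⟶ Z) (g : Y ⟶ Z)
    (h : pullback.fst f g ≫ f = pullback.snd f g ≫ g) :
    pullback.lift (pullback.fst f g) (pullback.snd f g) h = 𝟙 _ :=
  pullback.hom_ext (by rw [pullback.lift_fst, Category.id_comp])
    (by rw [pullback.lift_snd, Category.id_comp])

theorem lift_lift_fst_snd {X Y Z Z' T W : C} {f : X ⟶ Z} {g : Y ⟶ Z} {f' : X ⟶ Z'} {g' : Y ⟶ Z'}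
    {a : T ⟶ X} {b : T ⟶ Y} (h : a ≫ f = b ≫ g)
    (h' : pullback.fst f g ≫ f' = pullback.snd f g ≫ g') (k : pullback f' g' ⟶ W) :
    pullback.lift a b h ≫ pullback.lift (pullback.fst f g) (pullback.snd f g) h' ≫ k =
      pullback.lift a b (by
        have := congrArg (fun z => pullback.lift a b h ≫ z) h'
        simpa only [pullback.lift_fst_assoc, pullback.lift_snd_assoc] using this) ≫ k := by
  rw [← Category.assoc]
  congr 1
  apply pullback.hom_ext
  · rw [Category.assoc, pullback.lift_fst, pullback.lift_fst, pullback.lift_fst]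
  · rw [Category.assoc, pullback.lift_snd, pullback.lift_snd, pullback.lift_snd]

/-- Two internal groupoids with the same object `A` of morphisms are identified when there is an
isomorphism between them that is the identity on `A`, i.e. when they differ only by an isomorphic
choice of the object of objects. -/
instance setoid (A : C) : Setoid (GroupoidOn A) where
  r G H := ∃ e : G.obj ≅ H.obj,
    G.str.toInternalCategory.IsFunctor H.str.toInternalCategory e.hom (𝟙 A)
  iseqv :=
    { refl := fun G => by
        refine ⟨Iso.refl _, ?_, ?_, ?_, ?_⟩
        · simp
        · simp
        · simp
        · simp only [Category.comp_id]
          rw [lift_fst_snd_eq, Category.id_comp]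
      symm := by
        rintro G H ⟨e, hs, ht, hu, hm⟩
        refine ⟨e.symm, ?_, ?_, ?_, ?_⟩
        · rw [Category.id_comp] at hs
          simp [hs]
        · rw [Category.id_comp] at ht
          simp [ht]
        · rw [Category.comp_id] at hu
          simp [← hu]
        · simp only [Category.comp_id] at hm ⊢
          rw [hm, lift_lift_fst_snd, lift_fst_snd_eq, Category.id_comp]
      trans := by
        rintro G H K ⟨e, hs, ht, hu, hm⟩ ⟨e', hs', ht', hu', hm'⟩
        refine ⟨e ≪≫ e', ?_, ?_, ?_, ?_⟩
        · rw [Category.id_comp] at hs hs' ⊢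
          simp [hs, hs']
        · rw [Category.id_comp] at ht ht' ⊢
          simp [ht, ht']
        · rw [Category.comp_id] at hu hu' ⊢
          simp [hu, hu']
        · simp only [Category.comp_id] at hm hm' ⊢
          rw [hm, hm', lift_lift_fst_snd] }

end

section

variable {C : Type u} [Category.{v} C] [CartesianMonoidalCategory C] [Regular C] {A : C}

instance mono_compGraph (G : GroupoidOn A) :
    Mono (lift (lift (pullback.fst G.str.s G.str.t) (pullback.snd G.str.s G.str.t)) G.str.m) :=
  ⟨fun g h e => by
    have e' := congrArg (fun k => k ≫ fst (A ⊗ A) A) e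
    ext
    · simpa using congrArg (fun k => k ≫ fst A A) e'
    · simpa using congrArg (fun k => k ≫ snd A A) e'⟩

instance mono_unit (G : GroupoidOn A) : Mono (lift (toUnit G.obj) G.str.u) :=
  ⟨fun g h e => by
    have e' := congrArg (fun k => k ≫ snd (𝟙_ C) A ≫ G.str.s) e
    simpa [G.str.u_s] using e'⟩

/-- The composition of a groupoid as a relation `A × A ⇸ A`: the graph
`A × A ↢ A ×_{A₀} A ⟶ A` of the partial morphism `m`. -/
noncomputable def compRel (G : GroupoidOn A) :
    (⟨A⟩ ⊗ ⟨A⟩ : RelCategory C) ⟶ ⟨A⟩ :=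
  Subobject.mk
    (lift (lift (pullback.fst G.str.s G.str.t) (pullback.snd G.str.s G.str.t)) G.str.m)

/-- The identities `u : A₀ ↣ A` of a groupoid as a relation `1 ⇸ A`. -/
noncomputable def unitRel (G : GroupoidOn A) : 𝟙_ (RelCategory C) ⟶ ⟨A⟩ :=
  Subobject.mk (lift (toUnit G.obj) G.str.u)

end

end GroupoidOn

/-! A relation is determined by its generalised elements, and composition of relations is an
existential statement that has to be witnessed only after a regular epimorphic cover. The
comultiplication and counit are the daggers of `mul` and `one`, and the comonoid laws are the
daggers of the monoid laws. A special dagger Frobenius structure therefore amounts to relations `M`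
("`a b = c`") and `U` ("`x` is a unit") subject to the element-wise laws `IsFrobeniusRelation`. With
them the set-theoretic argument can be run internally, provided that each element found on a cover
is shown to be unique, so that it descends.

From relations to groupoids: speciality makes `M` single valued, hence a partial operation, and
products that exist locally exist. The unit laws give each `a` local units `x`, `y` with `a x = a`
and `y a = a`; associativity makes them unique, so they descend to source and target. The Frobenius
law, applied to `t(a) a = a = a s(a)`, produces inverses (`exists_inverse`). If `a b` is defined
then `s(a) = t(b)` (`composable`); conversely, if `s(a) = t(b)`, then `a = a t(b) = a (b b⁻¹)`, and
reassociating shows that `a b` is defined (`exists_mul`). So `M` is exactly the graph of a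
composition on `A ×_{A₀} A`, with `A₀` the subobject of units.

From groupoids to relations: every law is immediate except the Frobenius law, whose two sides are
exchanged by inverting the intermediate element. The relations determine the groupoid up to the
identification used here: the subobject of units fixes `A₀` up to a unique isomorphism over `A`, and
which products with identities are defined fixes `s` and `t` (`equiv_of_rel_eq`). -/

namespace RegRel

/-! ### Descent along covers, and the Frobenius laws on generalised elements -/

section

variable {C : Type u} [Category.{v} C]

/-- A morphism given on a regular epimorphic cover descends along the cover as soon as it is
compatible with the kernel pair. -/
theorem exists_desc {T T' Y : C} (p : T' ⟶ T) [IsRegularEpi p] (y : T' ⟶ Y)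
    (h : ∀ (S : C) (g k : S ⟶ T'), g ≫ p = k ≫ p → g ≫ y = k ≫ y) :
    ∃ f : T ⟶ Y, p ≫ f = y :=
  ⟨IsRegularEpi.desc p y (h _ _ _ (IsRegularEpi.w p)), IsRegularEpi.fac p y _⟩

variable [CartesianMonoidalCategory C]

theorem eq_lift {X Y T : C} (x : T ⟶ X ⊗ Y) : ∃ a b, x = lift a b :=
  ⟨x ≫ fst X Y, x ≫ snd X Y, (lift_comp_fst_snd _).symm⟩

theorem eq_iff_forall_mem {X Y : C} (R S : Subobject (X ⊗ Y)) :
    R = S ↔ ∀ (T : C) (a : T ⟶ X) (b : T ⟶ Y), Mem R a b ↔ Mem S a b :=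
  ⟨by rintro rfl; simp, ext_mem⟩

variable [Regular C] {A : C}

/-- The laws of a special dagger Frobenius structure, on generalised elements: `M` is the relation
`a b = c` and `U` is the subset of units. -/
structure IsFrobeniusRelation (M : Subobject ((A ⊗ A) ⊗ A)) (U : Subobject (𝟙_ C ⊗ A)) :
    Prop where
  one_mul {T : C} (a b : T ⟶ A) :
    (∃ (T' : C) (p : T' ⟶ T) (_ : IsRegularEpi p) (u : T' ⟶ A),
      Mem U (toUnit T') u ∧ Mem M (lift u (p ≫ a)) (p ≫ b)) ↔ a = b
  mul_one {T : C} (a b : T ⟶ A) :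
    (∃ (T' : C) (p : T' ⟶ T) (_ : IsRegularEpi p) (u : T' ⟶ A),
      Mem U (toUnit T') u ∧ Mem M (lift (p ≫ a) u) (p ≫ b)) ↔ a = b
  mul_assoc {T : C} (a b c d : T ⟶ A) :
    (∃ (T' : C) (p : T' ⟶ T) (_ : IsRegularEpi p) (e : T' ⟶ A),
      Mem M (lift (p ≫ a) (p ≫ b)) e ∧ Mem M (lift e (p ≫ c)) (p ≫ d)) ↔
    (∃ (T' : C) (p : T' ⟶ T) (_ : IsRegularEpi p) (e : T' ⟶ A),
      Mem M (lift (p ≫ b) (p ≫ c)) e ∧ Mem M (lift (p ≫ a) e) (p ≫ d))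
  frobenius {T : C} (a b c d : T ⟶ A) :
    (∃ (T' : C) (p : T' ⟶ T) (_ : IsRegularEpi p) (e : T' ⟶ A),
      Mem M (lift e (p ≫ d)) (p ≫ b) ∧ Mem M (lift (p ≫ a) e) (p ≫ c)) ↔
    (∃ (T' : C) (p : T' ⟶ T) (_ : IsRegularEpi p) (e : T' ⟶ A),
      Mem M (lift (p ≫ c) e) (p ≫ a) ∧ Mem M (lift e (p ≫ b)) (p ≫ d))
  special {T : C} (a b : T ⟶ A) :
    (∃ (T' : C) (p : T' ⟶ T) (_ : IsRegularEpi p) (x y : T' ⟶ A),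
      Mem M (lift x y) (p ≫ a) ∧ Mem M (lift x y) (p ≫ b)) ↔ a = b

/-- Maps into the terminal object carry no information, and the identity factor of the product
forces the second coordinate of the intermediate element; only the unit `u` remains to be chosen on
a cover. -/
theorem one_mul_iff (M : Subobject ((A ⊗ A) ⊗ A)) (U : Subobject (𝟙_ C ⊗ A)) :
    comp (prod U (graph (𝟙 A))) M = graph (λ_ A).hom ↔
      ∀ (T : C) (a b : T ⟶ A),
        (∃ (T' : C) (p : T' ⟶ T) (_ : IsRegularEpi p) (u : T' ⟶ A),
          Mem U (toUnit T') u ∧ Mem M (lift u (p ≫ a)) (p ≫ b)) ↔ a = b := by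
  have key : ∀ (T : C) (x : T ⟶ 𝟙_ C ⊗ A) (b : T ⟶ A),
      Mem (comp (prod U (graph (𝟙 A))) M) x b ↔
      ∃ (T' : C) (p : T' ⟶ T) (_ : IsRegularEpi p) (u : T' ⟶ A),
        Mem U (toUnit T') u ∧ Mem M (lift u (p ≫ x ≫ snd _ _)) (p ≫ b) := by
    intro T x b
    rw [mem_comp]
    refine exists_congr fun T' => exists_congr fun p => exists_congr fun hp => ?_
    constructor
    · rintro ⟨y, h, h'⟩
      obtain ⟨u, v, rfl⟩ := eq_lift y
      rw [mem_prod, mem_graph] at h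
      simp only [Category.assoc, Category.comp_id, lift_fst, lift_snd] at h
      rw [← h.2] at h'
      rw [toUnit_unique (p ≫ x ≫ fst _ _) (toUnit T')] at h
      exact ⟨u, h.1, h'⟩
    · rintro ⟨u, h, h'⟩
      refine ⟨_, ?_, h'⟩
      rw [mem_prod, mem_graph, toUnit_unique ((p ≫ x) ≫ fst _ _) (toUnit T')]
      simpa using h
  rw [eq_iff_forall_mem]
  constructor
  · intro h T a b
    have := h T (lift (toUnit T) a) b
    rw [key, mem_graph] at this
    simpa [leftUnitor_hom] using this
  · intro h T x b
    rw [key, mem_graph, leftUnitor_hom, h]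

theorem mul_one_iff (M : Subobject ((A ⊗ A) ⊗ A)) (U : Subobject (𝟙_ C ⊗ A)) :
    comp (prod (graph (𝟙 A)) U) M = graph (ρ_ A).hom ↔
      ∀ (T : C) (a b : T ⟶ A),
        (∃ (T' : C) (p : T' ⟶ T) (_ : IsRegularEpi p) (u : T' ⟶ A),
          Mem U (toUnit T') u ∧ Mem M (lift (p ≫ a) u) (p ≫ b)) ↔ a = b := by
  have key : ∀ (T : C) (x : T ⟶ A ⊗ 𝟙_ C) (b : T ⟶ A),
      Mem (comp (prod (graph (𝟙 A)) U) M) x b ↔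
      ∃ (T' : C) (p : T' ⟶ T) (_ : IsRegularEpi p) (u : T' ⟶ A),
        Mem U (toUnit T') u ∧ Mem M (lift (p ≫ x ≫ fst _ _) u) (p ≫ b) := by
    intro T x b
    rw [mem_comp]
    refine exists_congr fun T' => exists_congr fun p => exists_congr fun hp => ?_
    constructor
    · rintro ⟨y, h, h'⟩
      obtain ⟨u, v, rfl⟩ := eq_lift y
      rw [mem_prod, mem_graph] at h
      simp only [Category.assoc, Category.comp_id, lift_fst, lift_snd] at h
      rw [← h.1] at h'
      rw [toUnit_unique (p ≫ x ≫ snd _ _) (toUnit T')] at h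
      exact ⟨v, h.2, h'⟩
    · rintro ⟨u, h, h'⟩
      refine ⟨_, ?_, h'⟩
      rw [mem_prod, mem_graph, toUnit_unique ((p ≫ x) ≫ snd _ _) (toUnit T')]
      simpa using h
  rw [eq_iff_forall_mem]
  constructor
  · intro h T a b
    have := h T (lift a (toUnit T)) b
    rw [key, mem_graph] at this
    simpa [rightUnitor_hom] using this
  · intro h T x b
    rw [key, mem_graph, rightUnitor_hom, h]

theorem mul_assoc_iff (M : Subobject ((A ⊗ A) ⊗ A)) :
    comp (prod M (graph (𝟙 A))) M =
        comp (graph (α_ A A A).hom) (comp (prod (graph (𝟙 A)) M) M) ↔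
      ∀ (T : C) (a b c d : T ⟶ A),
        (∃ (T' : C) (p : T' ⟶ T) (_ : IsRegularEpi p) (e : T' ⟶ A),
          Mem M (lift (p ≫ a) (p ≫ b)) e ∧ Mem M (lift e (p ≫ c)) (p ≫ d)) ↔
        (∃ (T' : C) (p : T' ⟶ T) (_ : IsRegularEpi p) (e : T' ⟶ A),
          Mem M (lift (p ≫ b) (p ≫ c)) e ∧ Mem M (lift (p ≫ a) e) (p ≫ d)) := by
  have key₁ : ∀ (T : C) (a b c d : T ⟶ A),
      Mem (comp (prod M (graph (𝟙 A))) M) (lift (lift a b) c) d ↔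
      (∃ (T' : C) (p : T' ⟶ T) (_ : IsRegularEpi p) (e : T' ⟶ A),
          Mem M (lift (p ≫ a) (p ≫ b)) e ∧ Mem M (lift e (p ≫ c)) (p ≫ d)) := by
    intro T a b c d
    rw [mem_comp]
    refine exists_congr fun T' => exists_congr fun p => exists_congr fun hp => ?_
    constructor
    · rintro ⟨y, h, h'⟩
      obtain ⟨u, v, rfl⟩ := eq_lift y
      rw [mem_prod, mem_graph] at h
      simp only [comp_lift, Category.comp_id, lift_fst, lift_snd] at h
      rw [← h.2] at h'
      exact ⟨u, h.1, h'⟩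
    · rintro ⟨e, h, h'⟩
      refine ⟨_, ?_, h'⟩
      rw [mem_prod, mem_graph]
      simpa using h
  have key₂ : ∀ (T : C) (a b c d : T ⟶ A),
      Mem (comp (graph (α_ A A A).hom) (comp (prod (graph (𝟙 A)) M) M)) (lift (lift a b) c) d ↔
      (∃ (T' : C) (p : T' ⟶ T) (_ : IsRegularEpi p) (e : T' ⟶ A),
          Mem M (lift (p ≫ b) (p ≫ c)) e ∧ Mem M (lift (p ≫ a) e) (p ≫ d)) := by
    intro T a b c d
    rw [mem_graph_comp, lift_lift_associator_hom, mem_comp]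
    refine exists_congr fun T' => exists_congr fun p => exists_congr fun hp => ?_
    constructor
    · rintro ⟨y, h, h'⟩
      obtain ⟨u, v, rfl⟩ := eq_lift y
      rw [mem_prod, mem_graph] at h
      simp only [comp_lift, Category.comp_id, lift_fst, lift_snd] at h
      rw [← h.1] at h'
      exact ⟨v, h.2, h'⟩
    · rintro ⟨e, h, h'⟩
      refine ⟨_, ?_, h'⟩
      rw [mem_prod, mem_graph]
      simpa using h
  rw [eq_iff_forall_mem]
  constructor
  · intro h T a b c d
    rw [← key₁, ← key₂, h]
  · intro h T x d
    obtain ⟨y, c, rfl⟩ := eq_lift x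
    obtain ⟨a, b, rfl⟩ := eq_lift y
    rw [key₁, key₂, h]

/-- The left composite splits `b = e d` and returns `(a e, d)`; the right one splits `a = c e` and
returns `(c, e b)`. In both cases the identity factors determine every coordinate of the
intermediate element except `e`. -/
theorem frobenius_iff (M : Subobject ((A ⊗ A) ⊗ A)) :
    comp (prod (graph (𝟙 A)) (conv M)) (comp (graph (α_ A A A).inv) (prod M (graph (𝟙 A)))) =
        comp (prod (conv M) (graph (𝟙 A))) (comp (graph (α_ A A A).hom)
          (prod (graph (𝟙 A)) M)) ↔
      ∀ (T : C) (a b c d : T ⟶ A),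
        (∃ (T' : C) (p : T' ⟶ T) (_ : IsRegularEpi p) (e : T' ⟶ A),
          Mem M (lift e (p ≫ d)) (p ≫ b) ∧ Mem M (lift (p ≫ a) e) (p ≫ c)) ↔
        (∃ (T' : C) (p : T' ⟶ T) (_ : IsRegularEpi p) (e : T' ⟶ A),
          Mem M (lift (p ≫ c) e) (p ≫ a) ∧ Mem M (lift e (p ≫ b)) (p ≫ d)) := by
  have key₁ : ∀ (T : C) (a b c d : T ⟶ A),
      Mem (comp (prod (graph (𝟙 A)) (conv M)) (comp (graph (α_ A A A).inv)
        (prod M (graph (𝟙 A))))) (lift a b) (lift c d) ↔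
      (∃ (T' : C) (p : T' ⟶ T) (_ : IsRegularEpi p) (e : T' ⟶ A),
          Mem M (lift e (p ≫ d)) (p ≫ b) ∧ Mem M (lift (p ≫ a) e) (p ≫ c)) := by
    intro T a b c d
    rw [mem_comp]
    refine exists_congr fun T' => exists_congr fun p => exists_congr fun hp => ?_
    constructor
    · rintro ⟨y, h, h'⟩
      obtain ⟨u, y', rfl⟩ := eq_lift y
      obtain ⟨v, w, rfl⟩ := eq_lift y'
      rw [mem_prod, mem_graph, mem_conv] at h
      rw [mem_graph_comp, lift_lift_associator_inv, mem_prod, mem_graph] at h'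
      simp only [comp_lift, Category.comp_id, lift_fst, lift_snd] at h h'
      obtain ⟨rfl, h⟩ := h
      obtain ⟨h', rfl⟩ := h'
      exact ⟨v, h, h'⟩
    · rintro ⟨e, h, h'⟩
      refine ⟨lift (p ≫ a) (lift e (p ≫ d)), ?_, ?_⟩
      · rw [mem_prod, mem_graph, mem_conv]
        simpa using h
      · rw [mem_graph_comp, lift_lift_associator_inv, mem_prod, mem_graph]
        simpa using h'
  have key₂ : ∀ (T : C) (a b c d : T ⟶ A),
      Mem (comp (prod (conv M) (graph (𝟙 A))) (comp (graph (α_ A A A).hom)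
          (prod (graph (𝟙 A)) M))) (lift a b) (lift c d) ↔
      (∃ (T' : C) (p : T' ⟶ T) (_ : IsRegularEpi p) (e : T' ⟶ A),
          Mem M (lift (p ≫ c) e) (p ≫ a) ∧ Mem M (lift e (p ≫ b)) (p ≫ d)) := by
    intro T a b c d
    rw [mem_comp]
    refine exists_congr fun T' => exists_congr fun p => exists_congr fun hp => ?_
    constructor
    · rintro ⟨y, h, h'⟩
      obtain ⟨y', w, rfl⟩ := eq_lift y
      obtain ⟨u, v, rfl⟩ := eq_lift y'
      rw [mem_prod, mem_graph, mem_conv] at h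
      rw [mem_graph_comp, lift_lift_associator_hom, mem_prod, mem_graph] at h'
      simp only [comp_lift, Category.comp_id, lift_fst, lift_snd] at h h'
      obtain ⟨h, rfl⟩ := h
      obtain ⟨rfl, h'⟩ := h'
      exact ⟨v, h, h'⟩
    · rintro ⟨e, h, h'⟩
      refine ⟨lift (lift (p ≫ c) e) (p ≫ b), ?_, ?_⟩
      · rw [mem_prod, mem_graph, mem_conv]
        simpa using h
      · rw [mem_graph_comp, lift_lift_associator_hom, mem_prod, mem_graph]
        simpa using h'
  rw [eq_iff_forall_mem]
  constructor
  · intro h T a b c d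
    rw [← key₁, ← key₂, h]
  · intro h T x y
    obtain ⟨a, b, rfl⟩ := eq_lift x
    obtain ⟨c, d, rfl⟩ := eq_lift y
    rw [key₁, key₂, h]

theorem special_iff (M : Subobject ((A ⊗ A) ⊗ A)) :
    comp (conv M) M = graph (𝟙 A) ↔
      ∀ (T : C) (a b : T ⟶ A),
        (∃ (T' : C) (p : T' ⟶ T) (_ : IsRegularEpi p) (x y : T' ⟶ A),
          Mem M (lift x y) (p ≫ a) ∧ Mem M (lift x y) (p ≫ b)) ↔ a = b := by
  rw [eq_iff_forall_mem]
  refine forall_congr' fun T => forall_congr' fun a => forall_congr' fun b => ?_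
  rw [mem_comp, mem_graph, Category.comp_id]
  simp only [mem_conv]
  refine iff_congr (exists_congr fun T' => exists_congr fun p => exists_congr fun hp => ?_) Iff.rfl
  constructor
  · rintro ⟨z, h⟩
    obtain ⟨x, y, rfl⟩ := eq_lift z
    exact ⟨x, y, h⟩
  · rintro ⟨x, y, h⟩
    exact ⟨_, h⟩

end

end RegRel

/-! ### Reduction of the structure to its multiplication and unit -/

namespace SpecialDaggerFrobeniusStructure

open MonoidalDaggerCategory

section

variable {D : Type u} [Category.{v} D] [MonoidalCategory D] [MonoidalDaggerCategory D]

theorem dag_whiskerRight {X Y : D} (f : X ⟶ Y) (Z : D) : dag (f ▷ Z) = dag f ▷ Z := by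
  rw [← tensorHom_id, dag_tensor, dag_id, tensorHom_id]

theorem dag_whiskerLeft {X Y : D} (Z : D) (f : X ⟶ Y) : dag (Z ◁ f) = Z ◁ dag f := by
  rw [← id_tensorHom, dag_tensor, dag_id, id_tensorHom]

/-- A monoid whose multiplication satisfies the Frobenius law and speciality with respect to its
dagger is a special dagger Frobenius structure. -/
def ofMonObj {A : D} (m : MonObj A)
    (frob : A ◁ dag m.mul ≫ (α_ A A A).inv ≫ m.mul ▷ A =
      dag m.mul ▷ A ≫ (α_ A A A).hom ≫ A ◁ m.mul)
    (spec : dag m.mul ≫ m.mul = 𝟙 A) : SpecialDaggerFrobeniusStructure A where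
  toMonObj := m
  comul := dag m.mul
  counit := dag m.one
  -- The three comonoid laws are the daggers of the three monoid laws.
  counit_comul := by
    rw [← dag_whiskerRight, ← dag_comp, m.one_mul, dag_leftUnitor]
  comul_counit := by
    rw [← dag_whiskerLeft, ← dag_comp, m.mul_one, dag_rightUnitor]
  comul_assoc := by
    have h := congrArg dag m.mul_assoc
    simp only [dag_comp, dag_whiskerLeft, dag_whiskerRight, dag_associator,
      Category.assoc] at h
    rw [reassoc_of% h, Iso.inv_hom_id, Category.comp_id]
  frobenius := frob
  special := spec
  comul_eq := rfl
  counit_eq := rfl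

/-- The comultiplication and counit are forced to be the daggers, and the remaining fields are
propositions. -/
theorem ext_mul_one {A : D} {F G : SpecialDaggerFrobeniusStructure A} (hm : F.mul = G.mul)
    (ho : F.one = G.one) : F = G := by
  obtain ⟨⟨⟨f1, f2, _, _, _⟩, ⟨f3, f4, _, _, _⟩, _⟩, _, f5, f6⟩ := F
  obtain ⟨⟨⟨g1, g2, _, _, _⟩, ⟨g3, g4, _, _, _⟩, _⟩, _, g5, g6⟩ := G
  obtain rfl : f1 = g1 := ho
  obtain rfl : f2 = g2 := hm
  obtain rfl : f4 = g4 := f5.trans g5.symm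
  obtain rfl : f3 = g3 := f6.trans g6.symm
  rfl

end

section

variable {C : Type u} [Category.{v} C] [CartesianMonoidalCategory C] [Regular C] {A : C}

theorem isFrobeniusRelation (F : SpecialDaggerFrobeniusStructure (⟨A⟩ : RelCategory C)) :
    RegRel.IsFrobeniusRelation (A := A) F.mul F.one where
  one_mul := (RegRel.one_mul_iff (A := A) F.mul F.one).1 F.one_mul _
  mul_one := (RegRel.mul_one_iff (A := A) F.mul F.one).1 F.mul_one _
  mul_assoc := (RegRel.mul_assoc_iff (A := A) F.mul).1 F.mul_assoc _
  frobenius := (RegRel.frobenius_iff (A := A) F.mul).1 (by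
    have h := F.frobenius
    rw [F.comul_eq] at h
    exact h) _
  special := (RegRel.special_iff (A := A) F.mul).1 (by
    have h := F.special
    rw [F.comul_eq] at h
    exact h) _

/-- The special dagger Frobenius structure in `Rel(C)` given by relations that satisfy its laws on
generalised elements. -/
noncomputable def ofIsFrobeniusRelation {M : Subobject ((A ⊗ A) ⊗ A)} {U : Subobject (𝟙_ C ⊗ A)}
    (h : RegRel.IsFrobeniusRelation M U) :
    SpecialDaggerFrobeniusStructure (⟨A⟩ : RelCategory C) :=
  ofMonObj
    { one := U
      mul := M
      one_mul := (RegRel.one_mul_iff M U).2 fun _ => h.one_mul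
      mul_one := (RegRel.mul_one_iff M U).2 fun _ => h.mul_one
      mul_assoc := (RegRel.mul_assoc_iff M).2 fun _ => h.mul_assoc }
    ((RegRel.frobenius_iff M).2 fun _ => h.frobenius)
    ((RegRel.special_iff M).2 fun _ => h.special)

end

end SpecialDaggerFrobeniusStructure

/-! ### Sources, targets and inverses in a Frobenius relation -/

namespace RegRel

namespace IsFrobeniusRelation

section

variable {C : Type u} [Category.{v} C] [CartesianMonoidalCategory C] {A : C}
  {M : Subobject ((A ⊗ A) ⊗ A)} {U : Subobject (𝟙_ C ⊗ A)}

theorem mem_mul_precomp {T T' : C} {a b c : T ⟶ A} (hM : Mem M (lift a b) c) (p : T' ⟶ T) :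
    Mem M (lift (p ≫ a) (p ≫ b)) (p ≫ c) := by
  simpa using mem_precomp hM p

theorem mem_mul_of_cover {T T' : C} {a b c : T ⟶ A} (p : T' ⟶ T) [IsRegularEpi p]
    (hM : Mem M (lift (p ≫ a) (p ≫ b)) (p ≫ c)) : Mem M (lift a b) c :=
  mem_of_cover p (by simpa using hM)

theorem mem_one_precomp {T T' : C} {a : T ⟶ A} (hU : Mem U (toUnit T) a) (p : T' ⟶ T) :
    Mem U (toUnit T') (p ≫ a) := by
  simpa using mem_precomp hU p

theorem mem_one_of_cover {T T' : C} {a : T ⟶ A} (p : T' ⟶ T) [IsRegularEpi p]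
    (hU : Mem U (toUnit T') (p ≫ a)) : Mem U (toUnit T) a :=
  mem_of_cover p (by simpa using hU)

variable [Regular C] (h : IsFrobeniusRelation M U)

include h

/-- This is one half of speciality: splitting and then multiplying lies inside the diagonal. -/
theorem mul_unique {T : C} {a b c d : T ⟶ A} (h₁ : Mem M (lift a b) c)
    (h₂ : Mem M (lift a b) d) : c = d :=
  (h.special c d).1 ⟨T, 𝟙 T, inferInstance, a, b, by simpa using h₁, by simpa using h₂⟩

theorem eq_of_unit_left {T : C} {w a b : T ⟶ A} (hu : Mem U (toUnit T) w)
    (hM : Mem M (lift w a) b) : a = b :=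
  (h.one_mul a b).1 ⟨T, 𝟙 T, inferInstance, w, hu, by simpa using hM⟩

theorem eq_of_unit_right {T : C} {w a b : T ⟶ A} (hu : Mem U (toUnit T) w)
    (hM : Mem M (lift a w) b) : a = b :=
  (h.mul_one a b).1 ⟨T, 𝟙 T, inferInstance, w, hu, by simpa using hM⟩

/-- Since the multiplication is single valued, products that exist locally exist. -/
theorem exists_mul_of_cover {T T' : C} {a b : T ⟶ A} (p : T' ⟶ T) [IsRegularEpi p] {c : T' ⟶ A}
    (hM : Mem M (lift (p ≫ a) (p ≫ b)) c) : ∃ c', p ≫ c' = c ∧ Mem M (lift a b) c' := by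
  obtain ⟨c', rfl⟩ := exists_desc p c fun S g k e => by
    have h₁ := mem_mul_precomp hM g
    have h₂ := mem_mul_precomp hM k
    simp only [← Category.assoc, e] at h₁ h₂
    exact h.mul_unique h₁ h₂
  exact ⟨c', rfl, mem_mul_of_cover p hM⟩

/-- Associativity yields the inner product only on a cover; single-valuedness brings it down to `T`.
In particular the existence of `(a b) c` entails that of `b c`. -/
theorem exists_assoc_right {T : C} {a b c d e : T ⟶ A} (h₁ : Mem M (lift a b) e)
    (h₂ : Mem M (lift e c) d) : ∃ f, Mem M (lift b c) f ∧ Mem M (lift a f) d := by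
  obtain ⟨T', p, hp, f, h₃, h₄⟩ := (h.mul_assoc a b c d).1
    ⟨T, 𝟙 T, inferInstance, e, by simpa using h₁, by simpa using h₂⟩
  obtain ⟨f, rfl, h₅⟩ := h.exists_mul_of_cover p h₃
  exact ⟨f, h₅, mem_mul_of_cover p h₄⟩

theorem exists_assoc_left {T : C} {a b c d f : T ⟶ A} (h₁ : Mem M (lift b c) f)
    (h₂ : Mem M (lift a f) d) : ∃ e, Mem M (lift a b) e ∧ Mem M (lift e c) d := by
  obtain ⟨T', p, hp, e, h₃, h₄⟩ := (h.mul_assoc a b c d).2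
    ⟨T, 𝟙 T, inferInstance, f, by simpa using h₁, by simpa using h₂⟩
  obtain ⟨e, rfl, h₅⟩ := h.exists_mul_of_cover p h₃
  exact ⟨e, h₅, mem_mul_of_cover p h₄⟩

/-- Since `(a x) y = a`, the product `x y` is defined; as a product of two units it equals both `x`
and `y`. -/
theorem source_unique {T : C} {a x y : T ⟶ A} (hx : Mem U (toUnit T) x)
    (hy : Mem U (toUnit T) y) (h₁ : Mem M (lift a x) a) (h₂ : Mem M (lift a y) a) : x = y := by
  obtain ⟨f, h₃, -⟩ := h.exists_assoc_right h₁ h₂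
  rw [h.eq_of_unit_right hy h₃, h.eq_of_unit_left hx h₃]

theorem target_unique {T : C} {a x y : T ⟶ A} (hx : Mem U (toUnit T) x)
    (hy : Mem U (toUnit T) y) (h₁ : Mem M (lift x a) a) (h₂ : Mem M (lift y a) a) : x = y := by
  obtain ⟨f, h₃, -⟩ := h.exists_assoc_left h₂ h₁
  rw [h.eq_of_unit_right hy h₃, h.eq_of_unit_left hx h₃]

/-- The right unit law, at the generic element `𝟙 A`, gives a source on a cover; uniqueness makes it
compatible with the kernel pair. -/
theorem exists_source : ∃ x : A ⟶ A, Mem U (toUnit A) x ∧ Mem M (lift (𝟙 A) x) (𝟙 A) := by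
  obtain ⟨T, p, hp, x, hx, h₁⟩ := (h.mul_one (𝟙 A) (𝟙 A)).2 rfl
  obtain ⟨x, rfl⟩ := exists_desc p x fun S g k e => by
    have h₂ := mem_mul_precomp h₁ g
    have h₃ := mem_mul_precomp h₁ k
    simp only [Category.comp_id, e] at h₂ h₃
    exact h.source_unique (mem_one_precomp hx g) (mem_one_precomp hx k) h₂ h₃
  exact ⟨x, mem_one_of_cover p hx, mem_mul_of_cover p h₁⟩

theorem exists_target : ∃ x : A ⟶ A, Mem U (toUnit A) x ∧ Mem M (lift x (𝟙 A)) (𝟙 A) := by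
  obtain ⟨T, p, hp, x, hx, h₁⟩ := (h.one_mul (𝟙 A) (𝟙 A)).2 rfl
  obtain ⟨x, rfl⟩ := exists_desc p x fun S g k e => by
    have h₂ := mem_mul_precomp h₁ g
    have h₃ := mem_mul_precomp h₁ k
    simp only [Category.comp_id, e] at h₂ h₃
    exact h.target_unique (mem_one_precomp hx g) (mem_one_precomp hx k) h₂ h₃
  exact ⟨x, mem_one_of_cover p hx, mem_mul_of_cover p h₁⟩

/-- The identity on the source of a morphism. -/
noncomputable def source : A ⟶ A := h.exists_source.choose

/-- The identity on the target of a morphism. -/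
noncomputable def target : A ⟶ A := h.exists_target.choose

theorem mem_source {T : C} (a : T ⟶ A) : Mem U (toUnit T) (a ≫ h.source) :=
  mem_one_precomp h.exists_source.choose_spec.1 a

theorem mem_target {T : C} (a : T ⟶ A) : Mem U (toUnit T) (a ≫ h.target) :=
  mem_one_precomp h.exists_target.choose_spec.1 a

theorem mul_source {T : C} (a : T ⟶ A) : Mem M (lift a (a ≫ h.source)) a := by
  simpa [source] using mem_mul_precomp h.exists_source.choose_spec.2 a

theorem target_mul {T : C} (a : T ⟶ A) : Mem M (lift (a ≫ h.target) a) a := by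
  simpa [target] using mem_mul_precomp h.exists_target.choose_spec.2 a

theorem eq_source {T : C} {a x : T ⟶ A} (hx : Mem U (toUnit T) x) (hM : Mem M (lift a x) a) :
    a ≫ h.source = x :=
  h.source_unique (h.mem_source a) hx (h.mul_source a) hM

theorem eq_target {T : C} {a x : T ⟶ A} (hx : Mem U (toUnit T) x) (hM : Mem M (lift x a) a) :
    a ≫ h.target = x :=
  h.target_unique (h.mem_target a) hx (h.target_mul a) hM

/-- The product `x s(x) = x` can also be read as multiplication of `s(x)` by the unit `x`, which
gives `s(x)`. -/
theorem source_of_mem {T : C} {x : T ⟶ A} (hx : Mem U (toUnit T) x) : x ≫ h.source = x :=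
  h.eq_of_unit_left hx (h.mul_source x)

theorem target_of_mem {T : C} {x : T ⟶ A} (hx : Mem U (toUnit T) x) : x ≫ h.target = x :=
  h.eq_of_unit_right hx (h.target_mul x)

/-- Reassociating `(a s(a)) b = c` shows that `s(a) b` is defined. It equals `b`, so the unit `s(a)`
is the target of `b`. -/
theorem composable {T : C} {a b c : T ⟶ A} (hM : Mem M (lift a b) c) :
    a ≫ h.source = b ≫ h.target := by
  obtain ⟨f, h₁, -⟩ := h.exists_assoc_right (h.mul_source a) hM
  obtain rfl := h.eq_of_unit_left (h.mem_source a) h₁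
  exact (h.eq_target (h.mem_source a) h₁).symm

/-- Reassociating `a (b s(b)) = c` gives `c s(b) = c`. -/
theorem mul_comp_source {T : C} {a b c : T ⟶ A} (hM : Mem M (lift a b) c) :
    c ≫ h.source = b ≫ h.source := by
  obtain ⟨e, h₁, h₂⟩ := h.exists_assoc_left (h.mul_source b) hM
  obtain rfl := h.mul_unique hM h₁
  exact h.eq_source (h.mem_source b) h₂

theorem mul_comp_target {T : C} {a b c : T ⟶ A} (hM : Mem M (lift a b) c) :
    c ≫ h.target = a ≫ h.target := by
  obtain ⟨e, h₁, h₂⟩ := h.exists_assoc_right (h.target_mul a) hM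
  obtain rfl := h.mul_unique hM h₁
  exact h.eq_target (h.mem_target a) h₂

/-- The usual computation `x = x (a y) = (x a) y = y`, where `x t(a) = x` holds because
composability of `x` and `a` gives `s(x) = t(a)`. -/
theorem inverse_unique {T : C} {a x y : T ⟶ A} (h₁ : Mem M (lift x a) (a ≫ h.source))
    (h₂ : Mem M (lift a y) (a ≫ h.target)) : x = y := by
  have h₃ := h.mul_source x
  rw [h.composable h₁] at h₃
  obtain ⟨e, h₄, h₅⟩ := h.exists_assoc_left h₂ h₃
  obtain rfl := h.mul_unique h₁ h₄
  exact (h.eq_of_unit_left (h.mem_source a) h₅).symm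

theorem exists_inverse : ∃ x : A ⟶ A, Mem M (lift x (𝟙 A)) h.source ∧
    Mem M (lift (𝟙 A) x) h.target := by
  -- For generic `a`, the element `e = a` satisfies `t(a) e = a` and `e s(a) = a`. The other side of
  -- the Frobenius law is then an `x` with `x a = s(a)` and `a x = t(a)`.
  obtain ⟨T, p, hp, x, h₁, h₂⟩ := (h.frobenius (𝟙 A) h.source h.target (𝟙 A)).2
    ⟨A, 𝟙 A, inferInstance, 𝟙 A, by simpa using h.target_mul (𝟙 A),
      by simpa using h.mul_source (𝟙 A)⟩
  simp only [Category.comp_id] at h₁ h₂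
  -- One pullback of `x` is used as a left inverse and the other as a right inverse of the same
  -- element, so they agree.
  obtain ⟨x, rfl⟩ := exists_desc p x fun S g k e => by
    have h₃ := mem_mul_precomp h₁ g
    have h₄ := mem_mul_precomp h₂ k
    rw [← Category.assoc] at h₃ h₄
    rw [e] at h₃
    exact h.inverse_unique h₃ h₄
  exact ⟨x, mem_mul_of_cover p (by simpa using h₁), mem_mul_of_cover p (by simpa using h₂)⟩

/-- The inverse of a morphism. -/
noncomputable def inverse : A ⟶ A := h.exists_inverse.choose

theorem inverse_mul {T : C} (a : T ⟶ A) : Mem M (lift (a ≫ h.inverse) a) (a ≫ h.source) := by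
  simpa [inverse] using mem_mul_precomp h.exists_inverse.choose_spec.1 a

theorem mul_inverse {T : C} (a : T ⟶ A) : Mem M (lift a (a ≫ h.inverse)) (a ≫ h.target) := by
  simpa [inverse] using mem_mul_precomp h.exists_inverse.choose_spec.2 a

/-- Here inverses are needed: `a = a s(a) = a t(b) = a (b b⁻¹)`, and reassociating makes `a b`
defined. -/
theorem exists_mul {T : C} {a b : T ⟶ A} (hab : a ≫ h.source = b ≫ h.target) :
    ∃ c, Mem M (lift a b) c := by
  have h₁ := h.mul_source a
  rw [hab] at h₁
  obtain ⟨c, h₂, -⟩ := h.exists_assoc_left (h.mul_inverse b) h₁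
  exact ⟨c, h₂⟩

end

/-! ### The internal groupoid of a Frobenius relation -/

section

variable {C : Type u} [Category.{v} C] [CartesianMonoidalCategory C] {A : C}

/-- The inclusion into `A` of a subobject of `1 × A`. -/
noncomputable def incl (U : Subobject (𝟙_ C ⊗ A)) : (U : C) ⟶ A := U.arrow ≫ snd _ _

theorem mem_unit_iff {T : C} (U : Subobject (𝟙_ C ⊗ A)) (a : T ⟶ A) :
    Mem U (toUnit T) a ↔ ∃ k, k ≫ incl U = a := by
  rw [mem_iff]
  exact exists_congr fun k => and_iff_right (toUnit_unique _ _)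

instance (U : Subobject (𝟙_ C ⊗ A)) : Mono (incl U) :=
  ⟨fun g k e => by
    rw [← cancel_mono U.arrow]
    ext
    simpa [incl] using e⟩

theorem mem_incl {T : C} (U : Subobject (𝟙_ C ⊗ A)) (k : T ⟶ (U : C)) :
    Mem U (toUnit T) (k ≫ incl U) :=
  (mem_unit_iff U _).2 ⟨k, rfl⟩

variable [Regular C] {M : Subobject ((A ⊗ A) ⊗ A)} {U : Subobject (𝟙_ C ⊗ A)}
  (h : IsFrobeniusRelation M U)

/-- The source morphism of the groupoid of a Frobenius relation. -/
noncomputable def s : A ⟶ (U : C) := ((mem_unit_iff U _).1 h.exists_source.choose_spec.1).choose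

/-- The target morphism of the groupoid of a Frobenius relation. -/
noncomputable def t : A ⟶ (U : C) := ((mem_unit_iff U _).1 h.exists_target.choose_spec.1).choose

theorem s_incl : h.s ≫ incl U = h.source :=
  ((mem_unit_iff U _).1 h.exists_source.choose_spec.1).choose_spec

theorem t_incl : h.t ≫ incl U = h.target :=
  ((mem_unit_iff U _).1 h.exists_target.choose_spec.1).choose_spec

theorem comp_s_eq_comp_t_iff {T : C} (a b : T ⟶ A) :
    a ≫ h.s = b ≫ h.t ↔ a ≫ h.source = b ≫ h.target := by
  rw [← cancel_mono (incl U), Category.assoc, Category.assoc, s_incl, t_incl]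

theorem exists_comp : ∃ c, Mem M (lift (pullback.fst h.s h.t) (pullback.snd h.s h.t)) c :=
  h.exists_mul ((h.comp_s_eq_comp_t_iff _ _).1 pullback.condition)

/-- The composition of the groupoid of a Frobenius relation. -/
noncomputable def m : pullback h.s h.t ⟶ A := h.exists_comp.choose

theorem mem_lift_m {T : C} {a b : T ⟶ A} (hab : a ≫ h.s = b ≫ h.t) :
    Mem M (lift a b) (pullback.lift a b hab ≫ h.m) := by
  have h₁ := mem_mul_precomp h.exists_comp.choose_spec (pullback.lift a b hab)
  rwa [pullback.lift_fst, pullback.lift_snd] at h₁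

theorem lift_m_eq_iff {T : C} {a b c : T ⟶ A} (hab : a ≫ h.s = b ≫ h.t) :
    pullback.lift a b hab ≫ h.m = c ↔ Mem M (lift a b) c :=
  ⟨by rintro rfl; exact h.mem_lift_m hab, fun hc => h.mul_unique (h.mem_lift_m hab) hc⟩

/-- The internal groupoid of a Frobenius relation. -/
noncomputable def internalGroupoid : InternalGroupoid (U : C) A where
  s := h.s
  t := h.t
  u := incl U
  m := h.m
  u_s := by
    rw [← cancel_mono (incl U), Category.assoc, s_incl, Category.id_comp]
    exact h.source_of_mem (by simpa using mem_incl U (𝟙 _))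
  u_t := by
    rw [← cancel_mono (incl U), Category.assoc, t_incl, Category.id_comp]
    exact h.target_of_mem (by simpa using mem_incl U (𝟙 _))
  m_s := by
    rw [← cancel_mono (incl U), Category.assoc, Category.assoc, s_incl]
    exact h.mul_comp_source h.exists_comp.choose_spec
  m_t := by
    rw [← cancel_mono (incl U), Category.assoc, Category.assoc, t_incl]
    exact h.mul_comp_target h.exists_comp.choose_spec
  id_left := by
    rw [lift_m_eq_iff]
    simpa [t_incl] using h.target_mul (𝟙 A)
  id_right := by
    rw [lift_m_eq_iff]
    simpa [s_incl] using h.mul_source (𝟙 A)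
  assoc a b c hab hbc := by
    rw [lift_m_eq_iff]
    have h₁ : Mem M (lift b c) (pullback.lift b c hbc ≫ h.m) := h.mem_lift_m hbc
    -- Reassociating `a (b c)` produces some `e` with `a b = e`, which single-valuedness identifies
    -- with the chosen composite of `a` and `b`.
    obtain ⟨e, h₂, h₃⟩ := h.exists_assoc_left h₁ (h.mem_lift_m _)
    rwa [(h.lift_m_eq_iff hab).2 h₂]
  i := h.inverse
  i_s := by
    rw [← cancel_mono (incl U), Category.assoc, s_incl, t_incl]
    simpa using h.composable (h.inverse_mul (𝟙 A))
  i_t := by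
    rw [← cancel_mono (incl U), Category.assoc, s_incl, t_incl]
    simpa using (h.composable (h.mul_inverse (𝟙 A))).symm
  inv_left := by
    rw [lift_m_eq_iff, s_incl]
    simpa using h.inverse_mul (𝟙 A)
  inv_right := by
    rw [lift_m_eq_iff, t_incl]
    simpa using h.mul_inverse (𝟙 A)

end

end IsFrobeniusRelation

end RegRel

/-! ### Composition of generalised elements in an internal groupoid -/

namespace InternalGroupoid

section

variable {C : Type u} [Category.{v} C] [HasPullbacks C] {A₀ A : C}

/-- The generalised elements `a` and `b` are composable with composite `c`. -/
def IsComp (G : InternalGroupoid A₀ A) {T : C} (a b c : T ⟶ A) : Prop :=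
  ∃ h : a ≫ G.s = b ≫ G.t, pullback.lift a b h ≫ G.m = c

variable {G : InternalGroupoid A₀ A} {T : C} {a b c d e f : T ⟶ A}

namespace IsComp

theorem precomp {T' : C} (h : G.IsComp a b c) (p : T' ⟶ T) :
    G.IsComp (p ≫ a) (p ≫ b) (p ≫ c) := by
  obtain ⟨h, rfl⟩ := h
  have h' : (p ≫ a) ≫ G.s = (p ≫ b) ≫ G.t := by simp [h]
  refine ⟨h', ?_⟩
  rw [← Category.assoc p (pullback.lift a b h) G.m]
  congr 1
  apply pullback.hom_ext
  · rw [Category.assoc, pullback.lift_fst, pullback.lift_fst]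
  · rw [Category.assoc, pullback.lift_snd, pullback.lift_snd]

theorem unique (h₁ : G.IsComp a b c) (h₂ : G.IsComp a b d) : c = d := by
  obtain ⟨h₁, rfl⟩ := h₁
  obtain ⟨h₂, rfl⟩ := h₂
  rfl

theorem comp_s (h : G.IsComp a b c) : c ≫ G.s = b ≫ G.s := by
  obtain ⟨h, rfl⟩ := h
  rw [Category.assoc, G.m_s, pullback.lift_snd_assoc]

theorem comp_t (h : G.IsComp a b c) : c ≫ G.t = a ≫ G.t := by
  obtain ⟨h, rfl⟩ := h
  rw [Category.assoc, G.m_t, pullback.lift_fst_assoc]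

/-- Once `a b = e` and `b c = f` are defined, so are `e c` and `a f`, because `s(e) = s(b)` and
`t(f) = t(b)`. -/
theorem assoc_iff (h₁ : G.IsComp a b e) (h₂ : G.IsComp b c f) :
    G.IsComp e c d ↔ G.IsComp a f d := by
  have he := h₁.comp_s
  have hf := h₂.comp_t
  obtain ⟨h₁, rfl⟩ := h₁
  obtain ⟨h₂, rfl⟩ := h₂
  constructor
  · rintro ⟨h₃, rfl⟩
    exact ⟨h₁.trans hf.symm, (G.assoc a b c h₁ h₂).symm⟩
  · rintro ⟨h₃, rfl⟩
    exact ⟨he.trans h₂, G.assoc a b c h₁ h₂⟩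

end IsComp

variable (G)

theorem exists_isComp (h : a ≫ G.s = b ≫ G.t) : ∃ c, G.IsComp a b c :=
  ⟨_, h, rfl⟩

theorem isComp_target (a : T ⟶ A) : G.IsComp (a ≫ G.t ≫ G.u) a a := by
  simpa using IsComp.precomp (G := G) ⟨_, G.id_left⟩ a

theorem isComp_source (a : T ⟶ A) : G.IsComp a (a ≫ G.s ≫ G.u) a := by
  simpa using IsComp.precomp (G := G) ⟨_, G.id_right⟩ a

theorem isComp_inv_left (a : T ⟶ A) : G.IsComp (a ≫ G.i) a (a ≫ G.s ≫ G.u) := by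
  simpa using IsComp.precomp (G := G) ⟨_, G.inv_left⟩ a

theorem isComp_inv_right (a : T ⟶ A) : G.IsComp a (a ≫ G.i) (a ≫ G.t ≫ G.u) := by
  simpa using IsComp.precomp (G := G) ⟨_, G.inv_right⟩ a

variable {G}

/-- Composability forces `x = t(a)`, which reduces the claim to the left identity law. -/
theorem IsComp.eq_of_unit_left {x : T ⟶ A₀} (h : G.IsComp (x ≫ G.u) a b) : a = b := by
  have hx := h.choose
  rw [Category.assoc, G.u_s, Category.comp_id] at hx
  have h₁ := G.isComp_target a
  rw [← Category.assoc, ← hx] at h₁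
  exact h₁.unique h

theorem IsComp.eq_of_unit_right {x : T ⟶ A₀} (h : G.IsComp a (x ≫ G.u) b) : a = b := by
  have hx := h.choose
  rw [Category.assoc, G.u_t, Category.comp_id] at hx
  have h₁ := G.isComp_source a
  rw [← Category.assoc, hx] at h₁
  exact h₁.unique h

/-- Here `a⁻¹ (a b) = (a⁻¹ a) b`, and the identity on `s(a) = t(b)` acts trivially on `b`. This and
its mirror image give the Frobenius law. -/
theorem IsComp.inv_left (h : G.IsComp a b c) : G.IsComp (a ≫ G.i) c b := by
  rw [← IsComp.assoc_iff (G.isComp_inv_left a) h, ← Category.assoc, h.choose, Category.assoc]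
  exact G.isComp_target b

theorem IsComp.inv_right (h : G.IsComp a b c) : G.IsComp c (b ≫ G.i) a := by
  rw [IsComp.assoc_iff h (G.isComp_inv_right b), ← Category.assoc, ← h.choose, Category.assoc]
  exact G.isComp_source a

end

end InternalGroupoid

/-! ### From groupoids to Frobenius structures, and the bijection -/

namespace GroupoidOn

open RegRel

section

variable {C : Type u} [Category.{v} C] [CartesianMonoidalCategory C] [Regular C] {A : C}

theorem mem_compRel (G : GroupoidOn A) {T : C} (a b c : T ⟶ A) :
    Mem (A := A ⊗ A) (B := A) G.compRel (lift a b) c ↔ G.str.IsComp a b c := by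
  refine (mem_mk (lift (lift (pullback.fst G.str.s G.str.t) (pullback.snd G.str.s G.str.t))
    G.str.m) _ _).trans ?_
  constructor
  · rintro ⟨k, h₁, rfl⟩
    have ha := congrArg (fun z => z ≫ fst A A) h₁
    have hb := congrArg (fun z => z ≫ snd A A) h₁
    simp only [Category.assoc, lift_fst, lift_snd] at ha hb
    subst ha hb
    refine ⟨by rw [Category.assoc, Category.assoc, pullback.condition], ?_⟩
    rw [lift_snd]
    congr 1
    apply pullback.hom_ext
    · rw [pullback.lift_fst]
    · rw [pullback.lift_snd]
  · rintro ⟨h, rfl⟩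
    refine ⟨pullback.lift a b h, ?_, ?_⟩
    · rw [lift_fst, comp_lift, pullback.lift_fst, pullback.lift_snd]
    · rw [lift_snd]

theorem mem_unitRel (G : GroupoidOn A) {T : C} (x : T ⟶ A) :
    Mem (A := 𝟙_ C) (B := A) G.unitRel (toUnit T) x ↔ ∃ k, k ≫ G.str.u = x := by
  refine (mem_mk (lift (toUnit G.obj) G.str.u) _ _).trans ?_
  simp only [lift_snd]
  exact exists_congr fun k => and_iff_right (toUnit_unique _ _)

theorem isFrobeniusRelation (G : GroupoidOn A) :
    IsFrobeniusRelation (A := A) G.compRel G.unitRel where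
  one_mul {T} a b := by
    simp only [mem_compRel, mem_unitRel]
    constructor
    · rintro ⟨T', p, hp, _, ⟨k, rfl⟩, h⟩
      exact (cancel_epi p).1 h.eq_of_unit_left
    · rintro rfl
      exact ⟨T, 𝟙 T, inferInstance, _, ⟨a ≫ G.str.t, rfl⟩, by
        simpa using G.str.isComp_target a⟩
  mul_one {T} a b := by
    simp only [mem_compRel, mem_unitRel]
    constructor
    · rintro ⟨T', p, hp, _, ⟨k, rfl⟩, h⟩
      exact (cancel_epi p).1 h.eq_of_unit_right
    · rintro rfl
      exact ⟨T, 𝟙 T, inferInstance, _, ⟨a ≫ G.str.s, rfl⟩, by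
        simpa using G.str.isComp_source a⟩
  mul_assoc a b c d := by
    simp only [mem_compRel]
    refine exists_congr fun T' => exists_congr fun p => exists_congr fun hp => ?_
    constructor
    · rintro ⟨e, h₁, h₂⟩
      obtain ⟨f, h₃⟩ := G.str.exists_isComp (h₁.comp_s.symm.trans h₂.choose)
      exact ⟨f, h₃, (h₁.assoc_iff h₃).1 h₂⟩
    · rintro ⟨f, h₁, h₂⟩
      obtain ⟨e, h₃⟩ := G.str.exists_isComp (h₂.choose.trans h₁.comp_t)
      exact ⟨e, h₃, (h₃.assoc_iff h₁).2 h₂⟩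
  frobenius a b c d := by
    simp only [mem_compRel]
    refine exists_congr fun T' => exists_congr fun p => exists_congr fun hp => ?_
    -- From `e d = b` and `a e = c` follow `c e⁻¹ = a` and `e⁻¹ b = d`, and conversely, over the
    -- same cover.
    exact ⟨fun ⟨e, h₁, h₂⟩ => ⟨e ≫ G.str.i, h₂.inv_right, h₁.inv_left⟩,
      fun ⟨e, h₁, h₂⟩ => ⟨e ≫ G.str.i, h₂.inv_left, h₁.inv_right⟩⟩
  special {T} a b := by
    simp only [mem_compRel]
    constructor
    · rintro ⟨T', p, hp, x, y, h₁, h₂⟩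
      exact (cancel_epi p).1 (h₁.unique h₂)
    · rintro rfl
      -- Every element is a product: `a` is the composite of the identity on `t(a)` with `a`.
      exact ⟨T, 𝟙 T, inferInstance, _, a, by simpa using G.str.isComp_target a,
        by simpa using G.str.isComp_target a⟩

/-- One inequality is enough, since the identification of groupoids is symmetric. -/
theorem compRel_le {G H : GroupoidOn A} (h : G ≈ H) :
    LE.le (α := Subobject ((A ⊗ A) ⊗ A)) G.compRel H.compRel := by
  obtain ⟨e, hs, ht, -, hm⟩ := h
  refine le_of_mem (A := A ⊗ A) (B := A) fun T x c hx => ?_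
  obtain ⟨a, b, rfl⟩ := eq_lift x
  rw [mem_compRel] at hx ⊢
  obtain ⟨hab, rfl⟩ := hx
  rw [Category.id_comp] at hs ht
  refine ⟨by rw [hs, ht, reassoc_of% hab], ?_⟩
  simp only [Category.comp_id] at hm
  rw [hm, lift_lift_fst_snd]

theorem unitRel_le {G H : GroupoidOn A} (h : G ≈ H) :
    LE.le (α := Subobject (𝟙_ C ⊗ A)) G.unitRel H.unitRel := by
  obtain ⟨e, -, -, hu, -⟩ := h
  refine le_of_mem (A := 𝟙_ C) (B := A) fun T x c hx => ?_
  rw [toUnit_unique x (toUnit T), mem_unitRel] at hx ⊢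
  obtain ⟨k, rfl⟩ := hx
  exact ⟨k ≫ e.hom, by rw [Category.assoc, hu, Category.comp_id]⟩

/-- Equal subobjects of units give comparison maps `k`, `l` between the objects of objects; they are
mutually inverse because each `u` is split by `s`. -/
theorem equiv_of_rel_eq {G H : GroupoidOn A} (hm : G.compRel = H.compRel)
    (hu : G.unitRel = H.unitRel) : G ≈ H := by
  have hmul : ∀ {T : C} {a b c : T ⟶ A}, G.str.IsComp a b c → H.str.IsComp a b c :=
    fun {T a b c} h => by rwa [← mem_compRel, ← hm, mem_compRel]
  obtain ⟨k, hk⟩ := (mem_unitRel H G.str.u).1 (by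
    rw [← hu, mem_unitRel]
    exact ⟨𝟙 _, Category.id_comp _⟩)
  obtain ⟨l, hl⟩ := (mem_unitRel G H.str.u).1 (by
    rw [hu, mem_unitRel]
    exact ⟨𝟙 _, Category.id_comp _⟩)
  -- The composite of `a` with its source identity in `G` is also defined in `H`. Composability
  -- there says that the `H`-source of `a` is the `H`-target of that identity, which is `k` of the
  -- `G`-source.
  have hs : H.str.s = G.str.s ≫ k := by
    have h := (hmul (G.str.isComp_source (𝟙 A))).choose
    simpa [← hk, H.str.u_t] using h
  have ht : H.str.t = G.str.t ≫ k := by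
    have h := (hmul (G.str.isComp_target (𝟙 A))).choose
    simpa [← hk, H.str.u_s] using h.symm
  refine ⟨⟨k, l, ?_, ?_⟩, ?_, ?_, ?_, ?_⟩
  · have h : (k ≫ l) ≫ G.str.u = G.str.u := by rw [Category.assoc, hl, hk]
    simpa [G.str.u_s] using congrArg (fun z => z ≫ G.str.s) h
  · have h : (l ≫ k) ≫ H.str.u = H.str.u := by rw [Category.assoc, hk, hl]
    simpa [H.str.u_s] using congrArg (fun z => z ≫ H.str.s) h
  · simpa using hs
  · simpa using ht
  · simpa using hk
  · have h := hmul (T := pullback G.str.s G.str.t) ⟨pullback.condition, rfl⟩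
    obtain ⟨h₁, h₂⟩ := h
    simp only [Category.comp_id]
    rw [h₂, lift_fst_snd_eq, Category.id_comp]

/-- The special dagger Frobenius structure of an internal groupoid. -/
noncomputable def frobeniusStructure (G : GroupoidOn A) :
    SpecialDaggerFrobeniusStructure (⟨A⟩ : RelCategory C) :=
  SpecialDaggerFrobeniusStructure.ofIsFrobeniusRelation G.isFrobeniusRelation

theorem frobeniusStructure_eq_iff (G H : GroupoidOn A) :
    G.frobeniusStructure = H.frobeniusStructure ↔ G ≈ H :=
  ⟨fun h => equiv_of_rel_eq (congrArg (fun F => F.mul) h) (congrArg (fun F => F.one) h),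
    fun h => SpecialDaggerFrobeniusStructure.ext_mul_one
      (le_antisymm (α := Subobject ((A ⊗ A) ⊗ A)) (compRel_le h) (compRel_le (Setoid.symm h)))
      (le_antisymm (α := Subobject (𝟙_ C ⊗ A)) (unitRel_le h) (unitRel_le (Setoid.symm h)))⟩

theorem frobeniusStructure_surjective :
    Function.Surjective (frobeniusStructure : GroupoidOn A → _) := by
  intro F
  have h := F.isFrobeniusRelation
  refine ⟨⟨_, h.internalGroupoid⟩, SpecialDaggerFrobeniusStructure.ext_mul_one ?_ ?_⟩
  · refine ext_mem (A := A ⊗ A) (B := A) fun T x c => ?_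
    obtain ⟨a, b, rfl⟩ := eq_lift x
    refine (mem_compRel _ _ _ _).trans ?_
    -- The converse inclusion needs `composable`: `M` relates only pairs that lie in the pullback of
    -- source and target.
    exact ⟨fun ⟨hab, e⟩ => (h.lift_m_eq_iff hab).1 e, fun hc =>
      ⟨(h.comp_s_eq_comp_t_iff a b).2 (h.composable hc), (h.lift_m_eq_iff _).2 hc⟩⟩
  · refine ext_mem (A := 𝟙_ C) (B := A) fun T x c => ?_
    rw [toUnit_unique x (toUnit T)]
    exact (mem_unitRel _ _).trans (IsFrobeniusRelation.mem_unit_iff _ _).symm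

end

end GroupoidOn

theorem mainTheorem3 {C : Type u} [Category.{v} C] [CartesianMonoidalCategory C] [Regular C]
    (A : C) :
    ∃ Φ : Quotient (GroupoidOn.setoid A) ≃
        SpecialDaggerFrobeniusStructure (⟨A⟩ : RelCategory C),
      ∀ G : GroupoidOn A,
        (Φ (Quotient.mk _ G)).mul = G.compRel ∧ (Φ (Quotient.mk _ G)).one = G.unitRel :=
  ⟨Equiv.ofBijective
    (Quotient.lift GroupoidOn.frobeniusStructure fun G H h =>
      (GroupoidOn.frobeniusStructure_eq_iff G H).2 h)
    ⟨by
      rintro ⟨G⟩ ⟨H⟩ h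
      exact Quotient.sound ((GroupoidOn.frobeniusStructure_eq_iff G H).1 h),
    fun F => by
      obtain ⟨G, rfl⟩ := GroupoidOn.frobeniusStructure_surjective F
      exact ⟨Quotient.mk _ G, rfl⟩⟩,
    fun _ => ⟨rfl, rfl⟩⟩
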